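/- Let $\lambda_0$ be the unique real root of the cubic $4x^3-5x^2+9x-4$ (so $\lambda_0 \approx 0.53551$), and fix $\varepsilon > 0$. There are arbitrarily large finite sets $\mathcal{S}$ of prime numbers such that, writing $s := \#\mathcal{S}$, $$ \#\{(a,b,c) \in \mathbb{Z}^3 : a+b+1=c;\ \text{if a prime } p \mid abc \text{ then } p \in \mathcal{S};\ a,b,-c \neq -1\} \;\geq\; e^{s^{\lambda_0-\varepsilon}}. $$ That is, for every $N$ there is a finite set $\mathcal{S}$ of primes with $\#\mathcal{S} \ge N$ for which this inequality holds. -/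

import Mathlib

/-- The triples `(a, b, c)` of integers with `a + b + 1 = c`, such that every prime dividing `abc`
belongs to `S`, and with `a, b, -c ≠ -1`.
For a finite set `S` the condition on primes forces `abc ≠ 0`, because every prime divides `0`. -/
def sUnitSolutions (S : Finset ℕ) : Set (ℤ × ℤ × ℤ) :=
  {t | t.1 + t.2.1 + 1 = t.2.2 ∧
    (∀ p : ℕ, p.Prime → (p : ℤ) ∣ t.1 * t.2.1 * t.2.2 → p ∈ S) ∧
    t.1 ≠ -1 ∧ t.2.1 ≠ -1 ∧ -t.2.2 ≠ -1}

open Finset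

/-! Let A be the products of k primes of T₁, M the products of l primes of a disjoint T₂, and W the
product of T₁. For each m in M many pairs a < c in A agree mod m; pigeonholing (c - a)/m fixes one n
with many solutions of a + nm = c. Scaling by W/c and adding 1 makes the right side always W + 1, so
S only has to gain the primes of this n and of W + 1 (`exists_many_sUnitSolutions`). Few triples
collide (`card_triplesWithQuotient_le`).

Heuristically, with t primes of size t^(1+o(1)) in each set and k, l of order t^β, the count is
large when (1 - β)l + (1 - 2β)k > 0, while the congruence step needs l < (1 - β)k. Together these
allow β < 2 - √2 ≈ 0.586. Taking β near 0.55 suffices, so the cubic enters only through λ₀ < 0.55.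
-/

/-! ### Congruent pairs -/

/-- Cauchy-Schwarz: pairs of elements of a finite set that are congruent modulo `m`. -/
lemma sq_card_le_mul_card_congruent_pairs (A : Finset ℕ) {m : ℕ} (hm : 0 < m) :
    #A ^ 2 ≤ m * #{x ∈ A ×ˢ A | x.1 % m = x.2 % m} := by
  have hmaps : ∀ a ∈ A, a % m ∈ range m := fun a _ => mem_range.2 (Nat.mod_lt _ hm)
  have hpairs : ∀ x ∈ ({x ∈ A ×ˢ A | x.1 % m = x.2 % m} : Finset (ℕ × ℕ)),
      x.1 % m ∈ range m := fun x _ => mem_range.2 (Nat.mod_lt _ hm)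
  rw [card_eq_sum_card_fiberwise hmaps, card_eq_sum_card_fiberwise hpairs]
  have h := sq_sum_le_card_mul_sum_sq (s := range m) (f := fun r => #{a ∈ A | a % m = r})
  rw [card_range] at h
  refine h.trans (Nat.mul_le_mul_left _ (sum_le_sum fun r _ => ?_))
  rw [sq, ← card_product]
  refine card_le_card fun x hx => ?_
  simp only [mem_product, mem_filter] at hx ⊢
  exact ⟨⟨⟨hx.1.1, hx.2.1⟩, hx.1.2.trans hx.2.2.symm⟩, hx.1.2⟩

/-- If `A` has at least `2m` elements, then at least `|A|² / 4m` pairs `a < c` of elements of `A`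
are congruent modulo `m`. -/
lemma sq_card_le_four_mul_card_lt_congruent_pairs (A : Finset ℕ) {m : ℕ} (hm : 0 < m)
    (hA : 2 * m ≤ #A) :
    #A ^ 2 ≤ 4 * m * #{x ∈ A ×ˢ A | x.1 < x.2 ∧ m ∣ x.2 - x.1} := by
  set P := ({x ∈ A ×ˢ A | x.1 < x.2 ∧ m ∣ x.2 - x.1} : Finset (ℕ × ℕ)) with hP
  have hsub : ({x ∈ A ×ˢ A | x.1 % m = x.2 % m} : Finset (ℕ × ℕ)) ⊆
      A.diag ∪ (P ∪ P.image Prod.swap) := by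
    intro x hx
    simp only [mem_filter, mem_product] at hx
    obtain ⟨⟨h1, h2⟩, h⟩ := hx
    simp only [mem_union, mem_diag, mem_image, hP, mem_filter, mem_product]
    rcases lt_trichotomy x.1 x.2 with hlt | heq | hgt
    · exact Or.inr (Or.inl ⟨⟨h1, h2⟩, hlt, (Nat.modEq_iff_dvd' hlt.le).1 h⟩)
    · exact Or.inl ⟨h1, heq⟩
    · exact Or.inr (Or.inr ⟨x.swap, ⟨⟨h2, h1⟩, hgt, (Nat.modEq_iff_dvd' hgt.le).1 h.symm⟩,
        Prod.swap_swap x⟩)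
  have hcard : #{x ∈ A ×ˢ A | x.1 % m = x.2 % m} ≤ #A + (#P + #P) := by
    refine (card_le_card hsub).trans ((card_union_le _ _).trans ?_)
    rw [diag_card]
    exact Nat.add_le_add_left ((card_union_le _ _).trans (Nat.add_le_add_left card_image_le _)) _
  have h := (sq_card_le_mul_card_congruent_pairs A hm).trans (Nat.mul_le_mul_left m hcard)
  -- `hA` bounds the diagonal term m * #A by half of #A ^ 2.
  nlinarith

/-! ### Products of distinct primes -/

/-- Products of `k` distinct elements of `T`. -/
def subsetProducts (T : Finset ℕ) (k : ℕ) : Finset ℕ :=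
  (T.powersetCard k).image fun U => ∏ p ∈ U, p

lemma mem_subsetProducts {T : Finset ℕ} {k a : ℕ} :
    a ∈ subsetProducts T k ↔ ∃ U ⊆ T, #U = k ∧ ∏ p ∈ U, p = a := by
  simp [subsetProducts, and_assoc]

/-- By unique factorization, a subset is recovered as the prime factors of its product. -/
lemma card_subsetProducts {T : Finset ℕ} (hT : ∀ p ∈ T, p.Prime) (k : ℕ) :
    #(subsetProducts T k) = (#T).choose k := by
  rw [subsetProducts, card_image_of_injOn, card_powersetCard]
  intro U hU V hV h
  simp only [mem_coe, mem_powersetCard] at hU hV h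
  rw [← Nat.primeFactors_prod (s := U) fun p hp => hT p (hU.1 hp), h,
    Nat.primeFactors_prod fun p hp => hT p (hV.1 hp)]

lemma le_of_mem_subsetProducts {T : Finset ℕ} {k a y : ℕ} (hy : ∀ p ∈ T, p ≤ y)
    (ha : a ∈ subsetProducts T k) : a ≤ y ^ k := by
  obtain ⟨U, hU, rfl, rfl⟩ := mem_subsetProducts.1 ha
  exact prod_le_pow_card _ _ _ fun p hp => hy p (hU hp)

lemma ge_of_mem_subsetProducts {T : Finset ℕ} {k a z : ℕ} (hz : ∀ p ∈ T, z ≤ p)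
    (ha : a ∈ subsetProducts T k) : z ^ k ≤ a := by
  obtain ⟨U, hU, rfl, rfl⟩ := mem_subsetProducts.1 ha
  calc z ^ #U = ∏ _p ∈ U, z := by simp
    _ ≤ ∏ p ∈ U, p := prod_le_prod' fun p hp => hz p (hU hp)

lemma dvd_prod_of_mem_subsetProducts {T : Finset ℕ} {k a : ℕ}
    (ha : a ∈ subsetProducts T k) : a ∣ ∏ p ∈ T, p := by
  obtain ⟨U, hU, -, rfl⟩ := mem_subsetProducts.1 ha
  exact prod_dvd_prod_of_subset _ _ _ hU

lemma mem_of_prime_dvd_prod {T : Finset ℕ} (hT : ∀ p ∈ T, p.Prime) {p : ℕ} (hp : p.Prime)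
    (h : p ∣ ∏ x ∈ T, x) : p ∈ T := by
  obtain ⟨x, hx, hpx⟩ := (Prime.dvd_finsetProd_iff hp.prime _).1 h
  rwa [(Nat.prime_dvd_prime_iff_eq hp (hT x hx)).1 hpx]

lemma squarefree_prod_of_primes {T : Finset ℕ} (hT : ∀ p ∈ T, p.Prime) :
    Squarefree (∏ p ∈ T, p) := by
  refine squarefree_prod_of_pairwise_isCoprime (fun p hp q hq hpq => ?_)
    fun p hp => (hT p hp).prime.squarefree
  exact Nat.coprime_iff_isRelPrime.1 ((Nat.coprime_primes (hT p hp) (hT q hq)).2 hpq)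

/-- A set of prime factors of `n`, all at least `z`, has at most `log n / log z` elements. -/
lemma pow_card_le_of_subset_primeFactors {n z : ℕ} (hn : n ≠ 0) {P : Finset ℕ}
    (hP : P ⊆ n.primeFactors) (hz : ∀ p ∈ P, z ≤ p) : z ^ #P ≤ n := by
  calc z ^ #P = ∏ _p ∈ P, z := by simp
    _ ≤ ∏ p ∈ P, p := prod_le_prod' hz
    _ ≤ n := Nat.le_of_dvd (Nat.pos_of_ne_zero hn)
      ((prod_dvd_prod_of_subset _ _ _ hP).trans (Nat.prod_primeFactors_dvd n))

lemma card_primeFactors_le_log {n N : ℕ} (hn : n ≤ N) : #n.primeFactors ≤ Nat.log 2 N := by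
  rcases eq_or_ne n 0 with rfl | h0
  · simp
  · exact Nat.le_log_of_pow_le one_lt_two ((pow_card_le_of_subset_primeFactors h0 Subset.rfl
      fun p hp => (Nat.prime_of_mem_primeFactors hp).two_le).trans hn)

/-- Each of the k factors of the descending factorial is at least t + 1 - k ≥ kb, and k! ≤ k^k. -/
lemma pow_le_choose_of_mul_le {t k b : ℕ} (h : k * b ≤ t + 1 - k) : b ^ k ≤ t.choose k := by
  have h1 : k.factorial * b ^ k ≤ k.factorial * t.choose k := by
    rw [← Nat.descFactorial_eq_factorial_mul_choose]
    calc k.factorial * b ^ k ≤ k ^ k * b ^ k := by gcongr; exact Nat.factorial_le_pow k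
      _ = (k * b) ^ k := (mul_pow _ _ _).symm
      _ ≤ (t + 1 - k) ^ k := Nat.pow_le_pow_left h k
      _ ≤ t.descFactorial k := Nat.pow_sub_le_descFactorial t k
  exact Nat.le_of_mul_le_mul_left h1 k.factorial_pos

/-- Two pairs of positive integers in the same ratio and with the same gcd are equal. -/
lemma eq_of_mul_eq_mul_of_gcd_eq {a c a' c' : ℕ} (hc' : 0 < c')
    (h : a * c' = a' * c) (hg : a.gcd c = a'.gcd c') : c = c' := by
  have e1 : c' * a.gcd c = c * a'.gcd c' := by
    rw [← Nat.gcd_mul_left, ← Nat.gcd_mul_left, mul_comm c' a, h, mul_comm a' c, mul_comm c' c]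
  rw [hg] at e1
  exact (Nat.eq_of_mul_eq_mul_right (Nat.gcd_pos_of_pos_right _ hc') e1).symm

/-! ### Triples with a common quotient -/

/-- The triples `(m, a, c)` with `m` in `M` and `a < c` in `A` congruent modulo `m`. -/
def congruentTriples (M A : Finset ℕ) : Finset (ℕ × ℕ × ℕ) :=
  {x ∈ M ×ˢ A ×ˢ A | x.2.1 < x.2.2 ∧ x.1 ∣ x.2.2 - x.2.1}

lemma card_mul_sq_card_le_card_congruentTriples {M A : Finset ℕ} {Y : ℕ} (hM : ∀ m ∈ M, 0 < m)
    (hY : ∀ m ∈ M, m ≤ Y) (hA : 2 * Y ≤ #A) :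
    #M * #A ^ 2 ≤ 4 * Y * #(congruentTriples M A) := by
  have hmaps : ∀ x ∈ congruentTriples M A, x.1 ∈ M := fun x hx =>
    (mem_product.1 (mem_filter.1 hx).1).1
  rw [card_eq_sum_card_fiberwise hmaps, mul_sum, ← smul_eq_mul, ← sum_const]
  refine sum_le_sum fun m hm => ?_
  have h := sq_card_le_four_mul_card_lt_congruent_pairs A (hM m hm)
    ((Nat.mul_le_mul_left 2 (hY m hm)).trans hA)
  refine h.trans (Nat.mul_le_mul (Nat.mul_le_mul_left 4 (hY m hm)) ?_)
  refine card_le_card_of_injOn (fun x => (m, x)) (fun x hx => ?_) (fun x _ y _ h => by simpa using h)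
  simp only [coe_filter, Set.mem_ofPred_eq, mem_product, congruentTriples, mem_filter] at hx ⊢
  exact ⟨⟨⟨hm, hx.1⟩, hx.2⟩, trivial⟩

/-- The triples `(m, a, c)` as above with `c = a + n * m`. -/
def triplesWithQuotient (M A : Finset ℕ) (n : ℕ) : Finset (ℕ × ℕ × ℕ) :=
  {x ∈ M ×ˢ A ×ˢ A | x.2.1 + n * x.1 = x.2.2}

/-- Pigeonhole over the quotients `(c - a) / m`. -/
lemma exists_mul_card_congruentTriples_le {M A : Finset ℕ} {X Z : ℕ} (hZ : 0 < Z) (hZX : Z ≤ X)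
    (hM : ∀ m ∈ M, Z ≤ m) (hA : ∀ a ∈ A, a ≤ X) :
    ∃ n, 0 < n ∧ n ≤ X ∧
      Z * #(congruentTriples M A) ≤ X * #(triplesWithQuotient M A n) := by
  have hdiv : 1 ≤ X / Z := (Nat.one_le_div_iff hZ).2 hZX
  obtain ⟨n, hn, hmax⟩ := (Icc 1 (X / Z)).exists_max_image
    (fun n => #(triplesWithQuotient M A n)) ⟨1, mem_Icc.2 ⟨le_rfl, hdiv⟩⟩
  rw [mem_Icc] at hn
  refine ⟨n, hn.1, hn.2.trans (Nat.div_le_self _ _), ?_⟩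
  have hmaps : ∀ x ∈ congruentTriples M A, (x.2.2 - x.2.1) / x.1 ∈ Icc 1 (X / Z) := by
    intro x hx
    simp only [congruentTriples, mem_filter, mem_product] at hx
    obtain ⟨⟨hm, ha, hc⟩, hlt, hd⟩ := hx
    have hx0 : 0 < x.1 := hZ.trans_le (hM _ hm)
    refine mem_Icc.2 ⟨(Nat.one_le_div_iff hx0).2 (Nat.le_of_dvd (by omega) hd), ?_⟩
    exact Nat.div_le_div ((Nat.sub_le _ _).trans (hA _ hc)) (hM _ hm) hZ.ne'
  have hcard : #(congruentTriples M A) ≤ X / Z * #(triplesWithQuotient M A n) := by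
    rw [card_eq_sum_card_fiberwise hmaps]
    refine (sum_le_card_nsmul _ _ #(triplesWithQuotient M A n) fun j hj => ?_).trans (by simp)
    refine le_trans (card_le_card fun x hx => ?_) (hmax j hj)
    simp only [congruentTriples, triplesWithQuotient, mem_filter, mem_product] at hx ⊢
    obtain ⟨⟨h, hlt, hd⟩, rfl⟩ := hx
    refine ⟨h, ?_⟩
    rw [Nat.div_mul_cancel hd]
    omega
  calc Z * #(congruentTriples M A) ≤ Z * (X / Z * #(triplesWithQuotient M A n)) := by gcongr
    _ = Z * (X / Z) * #(triplesWithQuotient M A n) := by ring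
    _ ≤ X * #(triplesWithQuotient M A n) := by gcongr; exact Nat.mul_div_le X Z

/-! ### From triples to solutions -/

/-- If `a + n * m = c` and `c` divides `W`, then `W / c * a + W / c * (n * m) + 1 = W + 1`. -/
def scaledSolution (W n : ℕ) (x : ℕ × ℕ × ℕ) : ℤ × ℤ × ℤ :=
  (((W / x.2.2 * x.2.1 : ℕ) : ℤ), ((W / x.2.2 * (n * x.1) : ℕ) : ℤ), ((W + 1 : ℕ) : ℤ))

lemma scaledSolution_mem {T₁ T₂ : Finset ℕ} (h₁ : ∀ p ∈ T₁, p.Prime) (h₂ : ∀ p ∈ T₂, p.Prime)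
    {k l n : ℕ} (hn : n ≠ 0) {x : ℕ × ℕ × ℕ}
    (hx : x ∈ triplesWithQuotient (subsetProducts T₂ l) (subsetProducts T₁ k) n) :
    scaledSolution (∏ p ∈ T₁, p) n x ∈ sUnitSolutions
      (T₁ ∪ T₂ ∪ n.primeFactors ∪ (∏ p ∈ T₁, p + 1).primeFactors) := by
  obtain ⟨m, a, c⟩ := x
  simp only [triplesWithQuotient, mem_filter, mem_product] at hx
  obtain ⟨⟨hm, ha, hc⟩, hac⟩ := hx
  have hW : 0 < ∏ p ∈ T₁, p := prod_pos fun p hp => (h₁ p hp).pos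
  set W := ∏ p ∈ T₁, p
  have hcW : c ∣ W := dvd_prod_of_mem_subsetProducts hc
  refine ⟨?_, fun p hp hpd => ?_, ?_, ?_, ?_⟩
  · simp only [scaledSolution]
    have : W / c * a + W / c * (n * m) = W := by
      rw [← mul_add, hac, Nat.div_mul_cancel hcW]
    exact_mod_cast congrArg (· + 1) this
  · simp only [scaledSolution] at hpd
    norm_cast at hpd
    have hT₁ : p ∣ W → p ∈ T₁ := mem_of_prime_dvd_prod h₁ hp
    simp only [mem_union, Nat.mem_primeFactors_of_ne_zero hn,
      Nat.mem_primeFactors_of_ne_zero (Nat.succ_ne_zero W)]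
    rw [hp.dvd_mul, hp.dvd_mul, hp.dvd_mul, hp.dvd_mul, hp.dvd_mul] at hpd
    have hd : p ∣ W / c → p ∈ T₁ := fun h => hT₁ (h.trans (Nat.div_dvd_of_dvd hcW))
    have ha' : p ∣ a → p ∈ T₁ := fun h => hT₁ (h.trans (dvd_prod_of_mem_subsetProducts ha))
    have hm' : p ∣ m → p ∈ T₂ := fun h =>
      mem_of_prime_dvd_prod h₂ hp (h.trans (dvd_prod_of_mem_subsetProducts hm))
    tauto
  · simp only [scaledSolution]; omega
  · simp only [scaledSolution]; omega
  -- Here W > 0 is needed, to exclude W + 1 = 1.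
  · simp only [scaledSolution]; omega

/-- At most `2 ^ w` triples give the same solution, where `w` bounds the number of prime factors
of `n` in `T₁`: such triples are determined by `gcd(a, c)`, which divides `n`. -/
lemma card_triplesWithQuotient_le {T₁ T₂ : Finset ℕ} (h₁ : ∀ p ∈ T₁, p.Prime)
    (h₂ : ∀ p ∈ T₂, p.Prime) (hdisj : Disjoint T₁ T₂) {k l n w : ℕ} (hn : 0 < n)
    (hw : #(T₁ ∩ n.primeFactors) ≤ w) :
    #(triplesWithQuotient (subsetProducts T₂ l) (subsetProducts T₁ k) n) ≤
      2 ^ w * #((triplesWithQuotient (subsetProducts T₂ l) (subsetProducts T₁ k) n).image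
        (scaledSolution (∏ p ∈ T₁, p) n)) := by
  set W := ∏ p ∈ T₁, p with hWdef
  have hW : 0 < W := prod_pos fun p hp => (h₁ p hp).pos
  refine card_le_mul_card_image _ _ fun s _ => ?_
  refine le_trans ?_ ((card_powerset (T₁ ∩ n.primeFactors)).le.trans
    (Nat.pow_le_pow_right two_pos hw))
  refine card_le_card_of_injOn (fun x => (x.2.1.gcd x.2.2).primeFactors) ?_ ?_
  · rintro ⟨m, a, c⟩ hx
    simp only [triplesWithQuotient, coe_filter, mem_filter, mem_product, Set.mem_ofPred_eq] at hx
    obtain ⟨⟨⟨hm, ha, hc⟩, hac⟩, -⟩ := hx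
    simp only [mem_coe, mem_powerset]
    intro p hp
    have hpp := Nat.prime_of_mem_primeFactors hp
    have hpd := Nat.dvd_of_mem_primeFactors hp
    have hpa := hpd.trans (Nat.gcd_dvd_left a c)
    have hpc := hpd.trans (Nat.gcd_dvd_right a c)
    have hpT : p ∈ T₁ :=
      mem_of_prime_dvd_prod h₁ hpp (hpa.trans (dvd_prod_of_mem_subsetProducts ha))
    rw [← hac] at hpc
    refine mem_inter.2 ⟨hpT, (Nat.mem_primeFactors_of_ne_zero hn.ne').2 ⟨hpp, ?_⟩⟩
    -- A prime of gcd(a, c) divides nm, but lies in T₁ and so cannot divide m.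
    refine (hpp.dvd_mul.1 ((Nat.dvd_add_right hpa).1 hpc)).resolve_right fun hpm => ?_
    exact disjoint_left.1 hdisj hpT
      (mem_of_prime_dvd_prod h₂ hpp (hpm.trans (dvd_prod_of_mem_subsetProducts hm)))
  · rintro ⟨m, a, c⟩ hx ⟨m', a', c'⟩ hx' hg
    simp only [triplesWithQuotient, coe_filter, mem_filter, mem_product, Set.mem_ofPred_eq]
      at hx hx' hg
    obtain ⟨⟨⟨hm, ha, hc⟩, hac⟩, rfl⟩ := hx
    obtain ⟨⟨⟨hm', ha', hc'⟩, hac'⟩, hs⟩ := hx'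
    have hcW : c ∣ W := dvd_prod_of_mem_subsetProducts hc
    have hcW' : c' ∣ W := dvd_prod_of_mem_subsetProducts hc'
    have hsq : Squarefree W := squarefree_prod_of_primes h₁
    have hgcd : a.gcd c = a'.gcd c' := by
      rw [← Nat.prod_primeFactors_of_squarefree
          (hsq.squarefree_of_dvd ((Nat.gcd_dvd_right a c).trans hcW)), hg,
        Nat.prod_primeFactors_of_squarefree
          (hsq.squarefree_of_dvd ((Nat.gcd_dvd_right a' c').trans hcW'))]
    simp only [scaledSolution, Prod.mk.injEq, Nat.cast_inj] at hs
    -- The first coordinate gives a/c; with the squarefree gcd this recovers the pair.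
    have hratio : a * c' = a' * c := by
      refine Nat.eq_of_mul_eq_mul_left hW ?_
      calc W * (a * c') = (W / c * a) * (c * c') := by
            nth_rewrite 1 [← Nat.div_mul_cancel hcW]; ring
        _ = (W / c' * a') * (c * c') := by rw [hs.1]
        _ = W * (a' * c) := by nth_rewrite 2 [← Nat.div_mul_cancel hcW']; ring
    obtain rfl := eq_of_mul_eq_mul_of_gcd_eq (Nat.pos_of_dvd_of_pos hcW' hW) hratio hgcd
    obtain rfl := Nat.eq_of_mul_eq_mul_right (Nat.pos_of_dvd_of_pos hcW hW) hratio
    obtain rfl : m = m' := Nat.eq_of_mul_eq_mul_left hn (by omega)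
    rfl

/-- The main construction, with all parameters free. -/
theorem exists_many_sUnitSolutions {T₁ T₂ : Finset ℕ} (h₁ : ∀ p ∈ T₁, p.Prime)
    (h₂ : ∀ p ∈ T₂, p.Prime) (hdisj : Disjoint T₁ T₂) {y z k l w : ℕ} (hz : 0 < z)
    (hz₁ : ∀ p ∈ T₁, z ≤ p) (hz₂ : ∀ p ∈ T₂, z ≤ p) (hy₁ : ∀ p ∈ T₁, p ≤ y)
    (hy₂ : ∀ p ∈ T₂, p ≤ y) (hzy : z ^ l ≤ y ^ k) (hl : 2 * y ^ l ≤ (#T₁).choose k)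
    (hw : ∀ j, z ^ j ≤ y ^ k → j ≤ w) :
    ∃ S : Finset ℕ, (∀ p ∈ S, p.Prime) ∧ T₁ ⊆ S ∧
      #S ≤ #T₁ + #T₂ + Nat.log 2 (y ^ k) + Nat.log 2 (y ^ #T₁ + 1) ∧
      ∃ G : Finset (ℤ × ℤ × ℤ), (G : Set (ℤ × ℤ × ℤ)) ⊆ sUnitSolutions S ∧
        z ^ l * ((#T₂).choose l * (#T₁).choose k ^ 2) ≤ 4 * y ^ l * y ^ k * 2 ^ w * #G := by
  set M := subsetProducts T₂ l with hM
  set A := subsetProducts T₁ k with hA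
  have hMz : ∀ m ∈ M, z ^ l ≤ m := fun m hm => ge_of_mem_subsetProducts hz₂ hm
  have hMy : ∀ m ∈ M, m ≤ y ^ l := fun m hm => le_of_mem_subsetProducts hy₂ hm
  have hAy : ∀ a ∈ A, a ≤ y ^ k := fun a ha => le_of_mem_subsetProducts hy₁ ha
  have hzl : 0 < z ^ l := pow_pos hz l
  obtain ⟨n, hn, hnX, hcard⟩ := exists_mul_card_congruentTriples_le hzl hzy hMz hAy
  have hω : #(T₁ ∩ n.primeFactors) ≤ w := hw _ ((pow_card_le_of_subset_primeFactors hn.ne'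
    inter_subset_right fun p hp => hz₁ p (mem_inter.1 hp).1).trans hnX)
  refine ⟨T₁ ∪ T₂ ∪ n.primeFactors ∪ (∏ p ∈ T₁, p + 1).primeFactors, ?_, ?_, ?_,
    (triplesWithQuotient M A n).image (scaledSolution (∏ p ∈ T₁, p) n), ?_, ?_⟩
  · intro p hp
    simp only [mem_union] at hp
    rcases hp with ((hp | hp) | hp) | hp
    · exact h₁ p hp
    · exact h₂ p hp
    · exact Nat.prime_of_mem_primeFactors hp
    · exact Nat.prime_of_mem_primeFactors hp
  · intro p hp
    simp [hp]
  · have e1 := card_primeFactors_le_log hnX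
    have e2 := card_primeFactors_le_log
      (Nat.add_le_add_right (prod_le_pow_card T₁ (fun p => p) y hy₁) 1)
    have e3 := card_union_le (T₁ ∪ T₂ ∪ n.primeFactors) (∏ p ∈ T₁, p + 1).primeFactors
    have e4 := card_union_le (T₁ ∪ T₂) n.primeFactors
    have e5 := card_union_le T₁ T₂
    omega
  · intro s hs
    obtain ⟨x, hx, rfl⟩ := mem_image.1 (mem_coe.1 hs)
    exact scaledSolution_mem h₁ h₂ hn.ne' hx
  · have e1 := card_mul_sq_card_le_card_congruentTriples (A := A)
      (fun m hm => hzl.trans_le (hMz m hm)) hMy (by rwa [hA, card_subsetProducts h₁])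
    have e2 := card_triplesWithQuotient_le h₁ h₂ hdisj (k := k) (l := l) hn hω
    rw [hM, card_subsetProducts h₂, ← hM, hA, card_subsetProducts h₁, ← hA] at e1
    rw [← hM, ← hA] at e2
    calc z ^ l * ((#T₂).choose l * (#T₁).choose k ^ 2)
        ≤ z ^ l * (4 * y ^ l * #(congruentTriples M A)) := by gcongr
      _ = 4 * y ^ l * (z ^ l * #(congruentTriples M A)) := by ring
      _ ≤ 4 * y ^ l * (y ^ k * (2 ^ w * #((triplesWithQuotient M A n).image
            (scaledSolution (∏ p ∈ T₁, p) n)))) :=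
          Nat.mul_le_mul_left _ (hcard.trans (Nat.mul_le_mul_left _ e2))
      _ = _ := by ring

/-! ### Supply of primes and choice of parameters -/

/-- One factor q = 2^r absorbs the logarithm 100r of q^100, with room to spare. -/
lemma thousand_mul_le_two_pow {r : ℕ} (hr : 14 ≤ r) : 1000 * r ≤ 2 ^ r := by
  induction r, hr using Nat.le_induction with
  | base => norm_num
  | succ r hr ih => rw [pow_succ]; omega

/-- Chebyshev's lower bound at `x = 2 ^ (100 r)`. -/
lemma three_mul_le_primeCounting {r q : ℕ} (hr : 14 ≤ r) (hqdef : q = 2 ^ r) :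
    3 * q ^ 99 ≤ Nat.primeCounting (q ^ 100) := by
  have hq := hqdef ▸ thousand_mul_le_two_pow hr
  have hq1 : 1 ≤ q := by omega
  have hlog2 : (0 : ℝ) < Real.log 2 := Real.log_pos one_lt_two
  have hr0 : (0 : ℝ) < 100 * r := by positivity
  have hlog : Real.log ((q ^ 100 : ℕ) : ℝ) = 100 * r * Real.log 2 := by
    rw [hqdef]; push_cast; rw [Real.log_pow, Real.log_pow]; push_cast; ring
  have hlog1 : Real.log ((q ^ 100 : ℕ) + 1 : ℝ) ≤ (100 * r + 1) * Real.log 2 := by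
    have h1 : ((q ^ 100 : ℕ) : ℝ) + 1 ≤ 2 * ((q ^ 100 : ℕ) : ℝ) := by
      have : (1 : ℝ) ≤ ((q ^ 100 : ℕ) : ℝ) := by exact_mod_cast Nat.one_le_pow _ _ hq1
      linarith
    calc Real.log ((q ^ 100 : ℕ) + 1 : ℝ) ≤ Real.log (2 * ((q ^ 100 : ℕ) : ℝ)) :=
          Real.log_le_log (by positivity) h1
      _ = (100 * r + 1) * Real.log 2 := by
          rw [Real.log_mul two_ne_zero (by positivity), hlog]; ring
  have h := Chebyshev.pi_ge (q ^ 100)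
  rw [hlog, div_le_iff₀ (by positivity)] at h
  have hpi : ((q ^ 100 : ℕ) : ℝ) - (100 * r + 1) ≤
      Nat.primeCounting (q ^ 100) * (100 * r) := by
    refine le_of_mul_le_mul_right ?_ hlog2
    linarith
  have hnat : q ^ 100 ≤ Nat.primeCounting (q ^ 100) * (100 * r) + (100 * r + 1) := by
    have : ((q ^ 100 : ℕ) : ℝ) ≤
        ((Nat.primeCounting (q ^ 100) * (100 * r) + (100 * r + 1) : ℕ) : ℝ) := by
      push_cast at hpi ⊢; linarith
    exact_mod_cast this
  have hq99 : 1 ≤ q ^ 99 := Nat.one_le_pow _ _ hq1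
  by_contra hlt
  push Not at hlt
  have e1 : 1000 * r * q ^ 99 ≤ q ^ 100 := by
    rw [pow_succ' q 99]; exact Nat.mul_le_mul_right _ hq
  have e2 : Nat.primeCounting (q ^ 100) * (100 * r) ≤ 3 * q ^ 99 * (100 * r) :=
    Nat.mul_le_mul_right _ hlt.le
  have e3 : r ≤ r * q ^ 99 := Nat.le_mul_of_pos_right r hq99
  nlinarith

/-- Two disjoint large sets of primes between `q ^ 99` and `q ^ 100`, where `q = 2 ^ r`. -/
lemma exists_disjoint_prime_sets {r q : ℕ} (hr : 14 ≤ r) (hqdef : q = 2 ^ r) :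
    ∃ T₁ T₂ : Finset ℕ, Disjoint T₁ T₂ ∧ #T₁ = q ^ 99 ∧ #T₂ = q ^ 99 ∧
      ∀ p ∈ T₁ ∪ T₂, p.Prime ∧ q ^ 99 ≤ p ∧ p ≤ q ^ 100 := by
  have hπ := three_mul_le_primeCounting hr hqdef
  -- Of 3q^99 primes at most q^99 are discarded, leaving enough for both sets.
  set P := (Nat.primesLE (q ^ 100)) \ range (q ^ 99) with hP
  have hcard : 2 * q ^ 99 ≤ #P := by
    have h := le_card_sdiff (range (q ^ 99)) (Nat.primesLE (q ^ 100))
    rw [Nat.primesLE_card_eq_primeCounting, card_range, ← hP] at h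
    omega
  obtain ⟨T₁, hT₁, hc₁⟩ := exists_subset_card_eq (show q ^ 99 ≤ #P by omega)
  obtain ⟨T₂, hT₂, hc₂⟩ := exists_subset_card_eq (show q ^ 99 ≤ #(P \ T₁) by
    rw [card_sdiff_of_subset hT₁]; omega)
  refine ⟨T₁, T₂, (disjoint_sdiff.mono_right hT₂), hc₁, hc₂, fun p hp => ?_⟩
  have hpP : p ∈ P := (mem_union.1 hp).elim (@hT₁ p) fun h => sdiff_subset (hT₂ h)
  rw [hP, mem_sdiff, Nat.mem_primesLE, mem_range, not_lt] at hpP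
  exact ⟨hpP.1.2, hpP.2, hpP.1.1⟩

/-- There are sets of at most `q ^ 100` primes with at least `q ^ (q ^ 55)` solutions. -/
lemma exists_sUnitSolutions_two_pow {r q : ℕ} (hr : 14 ≤ r) (hqdef : q = 2 ^ r) :
    ∃ S : Finset ℕ, (∀ p ∈ S, p.Prime) ∧ q ^ 99 ≤ #S ∧ #S ≤ q ^ 100 ∧
      ∃ G : Finset (ℤ × ℤ × ℤ), (G : Set (ℤ × ℤ × ℤ)) ⊆ sUnitSolutions S ∧
        q ^ (q ^ 55) ≤ #G := by
  obtain ⟨T₁, T₂, hdisj, hc₁, hc₂, hT⟩ := exists_disjoint_prime_sets hr hqdef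
  have hq := hqdef ▸ thousand_mul_le_two_pow hr
  have hq0 : 0 < q := by omega
  have hq1 : 1 < q := by omega
  obtain ⟨u, hu⟩ : ∃ u, u = q ^ 55 := ⟨_, rfl⟩
  have hu0 : 0 < u := hu ▸ pow_pos hq0 _
  have hchoose : ∀ k, k ≤ 100 * u → (q ^ 43) ^ k ≤ (q ^ 99).choose k := by
    intro k hk
    refine pow_le_choose_of_mul_le ?_
    have e1 : u * q ^ 43 = q ^ 98 := by rw [hu, ← pow_add]
    have e2 : q ^ 99 = q ^ 98 * q := pow_succ _ _
    have e3 : u ≤ q ^ 98 := hu.le.trans <| Nat.pow_le_pow_right hq0 (by norm_num)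
    have e4 : k * q ^ 43 ≤ 100 * q ^ 98 := by
      rw [← e1, ← mul_assoc]; exact Nat.mul_le_mul_right _ hk
    have e5 : q ^ 98 * 14000 ≤ q ^ 99 := by rw [e2]; exact Nat.mul_le_mul_left _ (by omega)
    omega
  have hk := hchoose (100 * u) le_rfl
  have hl := hchoose (42 * u) (by omega)
  -- 42 < 43 secures `hl`; for w, 99j ≤ 10000u gives j ≤ 200u.
  obtain ⟨S, hS, hTS, hcard, G, hG, hmain⟩ := exists_many_sUnitSolutions
    (y := q ^ 100) (z := q ^ 99) (k := 100 * u) (l := 42 * u) (w := 200 * u)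
    (fun p hp => (hT p (mem_union_left _ hp)).1) (fun p hp => (hT p (mem_union_right _ hp)).1)
    hdisj (pow_pos hq0 _) (fun p hp => (hT p (mem_union_left _ hp)).2.1)
    (fun p hp => (hT p (mem_union_right _ hp)).2.1) (fun p hp => (hT p (mem_union_left _ hp)).2.2)
    (fun p hp => (hT p (mem_union_right _ hp)).2.2)
    (by rw [← pow_mul, ← pow_mul]; exact Nat.pow_le_pow_right hq0 (by omega))
    (by
      rw [hc₁]
      refine le_trans ?_ hk
      rw [← pow_mul, ← pow_mul]
      calc 2 * q ^ (100 * (42 * u)) ≤ q * q ^ (100 * (42 * u)) := Nat.mul_le_mul_right _ hq1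
        _ = q ^ (100 * (42 * u) + 1) := (pow_succ' _ _).symm
        _ ≤ q ^ (43 * (100 * u)) := Nat.pow_le_pow_right hq0 (by omega))
    (fun j hj => by
      rw [← pow_mul, ← pow_mul] at hj
      have := (Nat.pow_le_pow_iff_right hq1).1 hj
      omega)
  refine ⟨S, hS, hc₁ ▸ card_le_card hTS, ?_, G, hG, ?_⟩
  · have e1 : Nat.log 2 ((q ^ 100) ^ (100 * u)) = r * 100 * (100 * u) := by
      rw [hqdef, ← pow_mul, ← pow_mul, Nat.log_pow one_lt_two, mul_assoc]
    have e2 : Nat.log 2 ((q ^ 100) ^ #T₁ + 1) ≤ r * 100 * q ^ 99 + 1 := by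
      rw [hc₁]
      calc Nat.log 2 ((q ^ 100) ^ q ^ 99 + 1) ≤ Nat.log 2 (2 ^ (r * 100 * q ^ 99 + 1)) := by
            refine Nat.log_mono_right ?_
            rw [pow_succ 2, pow_mul, pow_mul, ← hqdef]
            have : 1 ≤ (q ^ 100) ^ q ^ 99 := Nat.one_le_pow _ _ (pow_pos hq0 _)
            omega
        _ = _ := Nat.log_pow one_lt_two _
    rw [e1, hc₁, hc₂] at hcard
    rw [hc₁] at e2
    have e3 : 1000 * r * q ^ 99 ≤ q ^ 100 := by
      rw [pow_succ' q 99]; exact Nat.mul_le_mul_right _ hq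
    have e4 : 14000 * u ≤ q ^ 99 :=
      calc 14000 * u ≤ q * q ^ 55 := hu ▸ Nat.mul_le_mul (by omega) le_rfl
        _ = q ^ 56 := (pow_succ' _ _).symm
        _ ≤ q ^ 99 := Nat.pow_le_pow_right hq0 (by norm_num)
    have e5 : r * (14000 * u) ≤ r * q ^ 99 := Nat.mul_le_mul_left _ e4
    have e6 : 14 * q ^ 99 ≤ r * q ^ 99 := Nat.mul_le_mul_right _ hr
    have e7 : 1 ≤ q ^ 99 := Nat.one_le_pow _ _ hq0
    nlinarith
  · rw [hc₁, hc₂] at hmain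
    have h1 : (q ^ 99) ^ (42 * u) * ((q ^ 43) ^ (42 * u) * ((q ^ 43) ^ (100 * u)) ^ 2) ≤
        4 * (q ^ 100) ^ (42 * u) * (q ^ 100) ^ (100 * u) * 2 ^ (200 * u) * #G :=
      le_trans (by gcongr) hmain
    -- In units of u: 99·42 + 43·42 + 2·43·100 = 14564, against 100·142 = 14200 on the right. The
    -- surplus 364 pays for 4·2^(200u) and leaves 64.
    have h2 : (q ^ 99) ^ (42 * u) * ((q ^ 43) ^ (42 * u) * ((q ^ 43) ^ (100 * u)) ^ 2) =
        q ^ (14200 * u) * q ^ (364 * u) := by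
      simp only [← pow_mul, ← pow_add]; congr 1; ring
    have h3 : 4 * (q ^ 100) ^ (42 * u) * (q ^ 100) ^ (100 * u) * 2 ^ (200 * u) * #G =
        q ^ (14200 * u) * (4 * 2 ^ (200 * u) * #G) := by
      have : (q ^ 100) ^ (42 * u) * (q ^ 100) ^ (100 * u) = q ^ (14200 * u) := by
        simp only [← pow_mul, ← pow_add]; congr 1; ring
      rw [← this]; ring
    rw [h2, h3] at h1
    have h4 : q ^ (364 * u) ≤ 4 * 2 ^ (200 * u) * #G :=
      Nat.le_of_mul_le_mul_left h1 (pow_pos hq0 _)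
    have h5 : 4 * 2 ^ (200 * u) ≤ q ^ (300 * u) :=
      calc 4 * 2 ^ (200 * u) = 2 ^ (200 * u + 2) := by rw [pow_add]; ring
        _ ≤ 2 ^ (300 * u) := Nat.pow_le_pow_right two_pos (by omega)
        _ ≤ q ^ (300 * u) := Nat.pow_le_pow_left hq1 _
    have h6 : q ^ (300 * u) * q ^ (64 * u) ≤ q ^ (300 * u) * #G := by
      rw [← pow_add, ← add_mul]; exact h4.trans (Nat.mul_le_mul_right _ h5)
    rw [← hu]
    exact (Nat.pow_le_pow_right hq0 (by omega)).trans
      (Nat.le_of_mul_le_mul_left h6 (pow_pos hq0 _))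

/-! ### The cubic and the conclusion -/

/-- The unique real root of the cubic, located by the intermediate value theorem. -/
lemma exists_cubic_root : ∃ lam₀ : ℝ,
    (∀ x : ℝ, 4 * x ^ 3 - 5 * x ^ 2 + 9 * x - 4 = 0 ↔ x = lam₀) ∧
      |lam₀ - 0.53551| ≤ 0.000005 := by
  have hcont : ContinuousOn (fun x : ℝ => 4 * x ^ 3 - 5 * x ^ 2 + 9 * x - 4)
      (Set.Icc 0.535505 0.535515) := by fun_prop
  obtain ⟨lam, hlam, h0⟩ := intermediate_value_Icc (by norm_num) hcont
    (show (0 : ℝ) ∈ Set.Icc _ _ by constructor <;> norm_num)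
  simp only at h0
  refine ⟨lam, fun x => ⟨fun hx => ?_, fun hx => hx ▸ h0⟩, ?_⟩
  · have hfac : (x - lam) * (4 * (x ^ 2 + x * lam + lam ^ 2) - 5 * (x + lam) + 9) = 0 := by
      linear_combination hx - h0
    -- With s = x + lam and d = x - lam this is 3s² - 5s + 9 + d².
    have hpos : 0 < 4 * (x ^ 2 + x * lam + lam ^ 2) - 5 * (x + lam) + 9 := by
      nlinarith [sq_nonneg (x - lam), sq_nonneg (x + lam - 1)]
    exact sub_eq_zero.1 ((mul_eq_zero.1 hfac).resolve_right hpos.ne')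
  · rw [abs_le]
    constructor <;> linarith [hlam.1, hlam.2]

theorem theorem2 :
    ∃ lam₀ : ℝ,
      (∀ x : ℝ, 4 * x ^ 3 - 5 * x ^ 2 + 9 * x - 4 = 0 ↔ x = lam₀) ∧
      |lam₀ - 0.53551| ≤ 0.000005 ∧
      ∀ ε : ℝ, 0 < ε → ∀ N : ℕ, ∃ S : Finset ℕ,
        (∀ p ∈ S, p.Prime) ∧ N ≤ S.card ∧
        ENNReal.ofReal (Real.exp ((S.card : ℝ) ^ (lam₀ - ε))) ≤
          ((sUnitSolutions S).encard : ENNReal) := by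
  obtain ⟨lam₀, hroot, happrox⟩ := exists_cubic_root
  refine ⟨lam₀, hroot, happrox, fun ε hε N => ?_⟩
  obtain ⟨q, hq⟩ : ∃ q, q = 2 ^ (N + 14) := ⟨_, rfl⟩
  obtain ⟨S, hS, hlow, hup, G, hG, hGcard⟩ :=
    exists_sUnitSolutions_two_pow (show 14 ≤ N + 14 by omega) hq
  have hNq : N + 14 < q := hq ▸ Nat.lt_two_pow_self
  have hNS : N ≤ #S :=
    (show N ≤ q by omega).trans ((Nat.le_self_pow (by norm_num) q).trans hlow)
  refine ⟨S, hS, hNS, ?_⟩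
  have hq1 : (1 : ℝ) ≤ q := by exact_mod_cast (by omega : 1 ≤ q)
  have hS1 : (1 : ℝ) ≤ #S := by
    exact_mod_cast (Nat.one_le_pow 99 q (by omega)).trans hlow
  have hexp : ((#S : ℕ) : ℝ) ^ (lam₀ - ε) ≤ ((q ^ 55 : ℕ) : ℝ) :=
    calc ((#S : ℕ) : ℝ) ^ (lam₀ - ε) ≤ (#S : ℝ) ^ (0.55 : ℝ) :=
          Real.rpow_le_rpow_of_exponent_le hS1 (by linarith [(abs_le.1 happrox).2])
      _ ≤ ((q : ℝ) ^ (100 : ℕ)) ^ (0.55 : ℝ) :=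
          Real.rpow_le_rpow (by positivity) (by exact_mod_cast hup) (by norm_num)
      _ = ((q ^ 55 : ℕ) : ℝ) := by
          rw [← Real.rpow_natCast, ← Real.rpow_mul (by positivity)]
          push_cast
          rw [← Real.rpow_natCast]
          norm_num
  have hle : Real.exp ((#S : ℝ) ^ (lam₀ - ε)) ≤ (#G : ℝ) :=
    calc Real.exp ((#S : ℝ) ^ (lam₀ - ε)) ≤ Real.exp ((q ^ 55 : ℕ) : ℝ) := Real.exp_le_exp.2 hexp
      _ = Real.exp 1 ^ (q ^ 55) := by rw [← Real.exp_nat_mul, mul_one]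
      _ ≤ (q : ℝ) ^ (q ^ 55) := by
          have h14 : (14 : ℝ) ≤ q := by exact_mod_cast (by omega : 14 ≤ q)
          exact pow_le_pow_left₀ (Real.exp_pos 1).le
            (Real.exp_one_lt_three.le.trans (by linarith)) _
      _ ≤ #G := by exact_mod_cast hGcard
  calc ENNReal.ofReal (Real.exp ((#S : ℝ) ^ (lam₀ - ε))) ≤ ENNReal.ofReal (#G : ℝ) :=
        ENNReal.ofReal_le_ofReal hle
    _ = (((G : Set (ℤ × ℤ × ℤ)).encard : ℕ∞) : ENNReal) := by
        rw [ENNReal.ofReal_natCast, Set.encard_coe_eq_coe_finsetCard, ENat.toENNReal_coe]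
    _ ≤ _ := ENat.toENNReal_le.2 (Set.encard_le_encard hG)
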